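/- Let $-\infty<a<b<\infty$ and let $p,q,r$ be real-valued functions on $(a,b)$ with $p>0$ and $r>0$ a.e. and $1/p,\,q,\,r\in L^1((a,b);dx)$. For $u\in AC([a,b])$ put $u^{[1]}=pu'$ and $\tau u=r^{-1}\big[-(u^{[1]})'+qu\big]$, and let $H_{\max}f=\tau f$ in $L^2((a,b);r\,dx)$ with $$\operatorname{dom}(H_{\max})=\{g\in L^2((a,b);r\,dx)\,:\,g,g^{[1]}\in AC([a,b]),\ \tau g\in L^2((a,b);r\,dx)\}.$$ A pair $A,B\in\mathbb C^{2\times2}$ is called admissible if $$\operatorname{rank}(A\ \ B)=2,\qquad AJA^*=BJB^*,\qquad J=\begin{pmatrix}0&-1\\1&0\end{pmatrix}.$$ For such a pair define, for functions $u$ with $u,u^{[1]}\in AC([a,b])$, $$\gamma_{A,B}u=A\binom{u(a)}{u^{[1]}(a)}-B\binom{u(b)}{u^{[1]}(b)},\qquad \gamma_Du=\binom{u(a)}{u(b)},\qquad \gamma_Nu=\binom{u^{[1]}(a)}{-u^{[1]}(b)},$$ the matrices $$D_{A,B}=\begin{pmatrix}A_{1,1}&-B_{1,1}\\A_{2,1}&-B_{2,1}\end{pmatrix},\qquad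 N_{A,B}=\begin{pmatrix}A_{1,2}&B_{1,2}\\A_{2,2}&B_{2,2}\end{pmatrix}$$ (so that $\gamma_{A,B}=D_{A,B}\gamma_D+N_{A,B}\gamma_N$), and the complementary trace $$\gamma^\perp_{A,B}=[D_{A,B}D_{A,B}^*+N_{A,B}N_{A,B}^*]^{-1}\big(-N_{A,B}\gamma_D+D_{A,B}\gamma_N\big).$$ Let $H_{A,B}$ be the (self-adjoint) restriction of $H_{\max}$ to $\{g\in\operatorname{dom}(H_{\max}):\gamma_{A,B}g=0\}$, with resolvent set $\rho(H_{A,B})$. Let $A,B$ and $A',B'$ be admissible pairs, let $S_{A',B',A,B}=N_{A',B'}D_{A,B}^*-D_{A',B'}N_{A,B}^*$, and let $z\in\rho(H_{A,B})$. Then for every $c\in\mathbb C^2$ the boundary value problem $$-(u^{[1]})'+qu=zru\ \text{ a.e. on }(a,b),\qquad u,u^{[1]}\in AC([a,b]),\qquad \gamma_{A,B}u=c,$$ has a unique solution $u_{A,B}(z,\cdot\,;c)$ on $[a,b]$, so that the boundary data map $\Lambda_{A,B}^{A',B'}(z):\mathbb C^2\to\mathbb C^2$, $\Lambda_{A,B}^{A',B'}(z)c=\gamma_{A',B'}u_{A,B}(z,\cdot\,;c)$,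 is well defined. Moreover $\bar z\in\rho(H_{A,B})$, the operators $\gamma_{A',B'}(H_{A,B}-\bar z)^{-1}$ and $\gamma^\perp_{A,B}(H_{A,B}-\bar z)^{-1}$ from $L^2((a,b);r\,dx)$ to $\mathbb C^2$ are bounded, their adjoints map $\mathbb C^2$ into $\operatorname{dom}(H_{\max})$, and $$\Lambda_{A,B}^{A',B'}(z)\,S^*_{A',B',A,B}=\gamma_{A',B'}\big[\gamma_{A',B'}(H_{A,B}-\bar z)^{-1}\big]^*,$$ $$\Lambda_{A,B}^{A',B'}(z)=\gamma_{A',B'}\big[\gamma^\perp_{A,B}(H_{A,B}-\bar z)^{-1}\big]^*.$$ -/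

import Mathlib

open MeasureTheory Set
open scoped Matrix InnerProductSpace ComplexConjugate

noncomputable section

namespace SturmLiouville

/-! ### Resolvents of (possibly unbounded) operators in a Hilbert space -/

section Resolvent

variable {E : Type*} [NormedAddCommGroup E] [InnerProductSpace ℂ E]

/-- `R` is the bounded, everywhere defined inverse of `T - z I : dom T → E`. -/
structure IsResolventAt (T : E →ₗ.[ℂ] E) (z : ℂ) (R : E →L[ℂ] E) : Prop where
  mem_domain : ∀ f : E, R f ∈ T.domain
  right_inv : ∀ f : E, T ⟨R f, mem_domain f⟩ - z • R f = f
  left_inv : ∀ g : T.domain, R (T g - z • (g : E)) = g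

/-- The resolvent set `ρ(T)`. -/
def resolventSet (T : E →ₗ.[ℂ] E) : Set ℂ :=
  {z | ∃ R : E →L[ℂ] E, IsResolventAt T z R}

/-- The resolvent `(T - z I)⁻¹`, for `z ∈ ρ(T)`. -/
def resolvent (T : E →ₗ.[ℂ] E) {z : ℂ} (hz : z ∈ resolventSet T) : E →L[ℂ] E :=
  Classical.choose hz

theorem isResolventAt_resolvent (T : E →ₗ.[ℂ] E) {z : ℂ} (hz : z ∈ resolventSet T) :
    IsResolventAt T z (resolvent T hz) :=
  Classical.choose_spec hz

end Resolvent

/-! ### Matrices attached to a boundary condition -/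

/-- `J = (0 -1; 1 0)`. -/
def symplecticJ : Matrix (Fin 2) (Fin 2) ℂ := !![0, -1; 1, 0]

/-- The condition `rank (A  B) = 2`, `A J A* = B J B*`, which describes the pairs `(A, B)` that
parametrize self-adjoint boundary conditions. -/
structure IsBoundaryPair (A B : Matrix (Fin 2) (Fin 2) ℂ) : Prop where
  rank_eq : (Matrix.fromCols A B).rank = 2
  symplectic : A * symplecticJ * Aᴴ = B * symplecticJ * Bᴴ

/-- `D_{A,B} = (A₁₁ -B₁₁; A₂₁ -B₂₁)`. -/
def matD (A B : Matrix (Fin 2) (Fin 2) ℂ) : Matrix (Fin 2) (Fin 2) ℂ :=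
  !![A 0 0, -B 0 0; A 1 0, -B 1 0]

/-- `N_{A,B} = (A₁₂ B₁₂; A₂₂ B₂₂)`. -/
def matN (A B : Matrix (Fin 2) (Fin 2) ℂ) : Matrix (Fin 2) (Fin 2) ℂ :=
  !![A 0 1, B 0 1; A 1 1, B 1 1]

/-- `D⊥_{A,B} = -[D D* + N N*]⁻¹ N`; the inverse exists when `rank (A  B) = 2`. -/
def matDPerp (A B : Matrix (Fin 2) (Fin 2) ℂ) : Matrix (Fin 2) (Fin 2) ℂ :=
  -((matD A B * (matD A B)ᴴ + matN A B * (matN A B)ᴴ)⁻¹ * matN A B)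

/-- `N⊥_{A,B} = [D D* + N N*]⁻¹ D`. -/
def matNPerp (A B : Matrix (Fin 2) (Fin 2) ℂ) : Matrix (Fin 2) (Fin 2) ℂ :=
  (matD A B * (matD A B)ᴴ + matN A B * (matN A B)ᴴ)⁻¹ * matD A B

/-- `S_{A',B',A,B} = N_{A',B'} D_{A,B}* - D_{A',B'} N_{A,B}*`. -/
def matS (A' B' A B : Matrix (Fin 2) (Fin 2) ℂ) : Matrix (Fin 2) (Fin 2) ℂ :=
  matN A' B' * (matD A B)ᴴ - matD A' B' * (matN A B)ᴴ

/-! ### Boundary traces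

They act on pairs `w = (u, u^{[1]})` of a function and its quasi-derivative. -/

/-- The pair `(w₁(x), w₂(x))` in `ℂ²`. -/
def evalPair (x : ℝ) : (ℝ → ℂ) × (ℝ → ℂ) →ₗ[ℂ] EuclideanSpace ℂ (Fin 2) where
  toFun w := !₂[w.1 x, w.2 x]
  map_add' w w' := by ext i; fin_cases i <;> simp
  map_smul' c w := by ext i; fin_cases i <;> simp

/-- The Dirichlet trace `γ_D u = (u(a), u(b))`. -/
def traceD (a b : ℝ) : (ℝ → ℂ) × (ℝ → ℂ) →ₗ[ℂ] EuclideanSpace ℂ (Fin 2) where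
  toFun w := !₂[w.1 a, w.1 b]
  map_add' w w' := by ext i; fin_cases i <;> simp
  map_smul' c w := by ext i; fin_cases i <;> simp

/-- The Neumann trace `γ_N u = (u^{[1]}(a), -u^{[1]}(b))`. -/
def traceN (a b : ℝ) : (ℝ → ℂ) × (ℝ → ℂ) →ₗ[ℂ] EuclideanSpace ℂ (Fin 2) where
  toFun w := !₂[w.2 a, -w.2 b]
  map_add' w w' := by ext i; fin_cases i <;> simp [add_comm]
  map_smul' c w := by ext i; fin_cases i <;> simp

/-- The general boundary trace
`γ_{A,B} u = A (u(a), u^{[1]}(a)) - B (u(b), u^{[1]}(b))`. -/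
def traceAB (a b : ℝ) (A B : Matrix (Fin 2) (Fin 2) ℂ) :
    (ℝ → ℂ) × (ℝ → ℂ) →ₗ[ℂ] EuclideanSpace ℂ (Fin 2) :=
  Matrix.toEuclideanLin A ∘ₗ evalPair a - Matrix.toEuclideanLin B ∘ₗ evalPair b

/-- The complementary boundary trace `γ⊥_{A,B} = D⊥_{A,B} γ_D + N⊥_{A,B} γ_N`. -/
def tracePerp (a b : ℝ) (A B : Matrix (Fin 2) (Fin 2) ℂ) :
    (ℝ → ℂ) × (ℝ → ℂ) →ₗ[ℂ] EuclideanSpace ℂ (Fin 2) :=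
  Matrix.toEuclideanLin (matDPerp A B) ∘ₗ traceD a b +
    Matrix.toEuclideanLin (matNPerp A B) ∘ₗ traceN a b

/-! ### Regular Sturm–Liouville expressions -/

/-- The coefficients of a regular three-coefficient Sturm–Liouville differential expression
`τ = r⁻¹ [-(d/dx) p (d/dx) + q]` on a bounded interval `(a, b)`: `p, r > 0` a.e., `q` is real and
`1/p, q, r ∈ L¹((a, b); dx)`. -/
structure Coeff where
  (a b : ℝ)
  (p q r : ℝ → ℝ)
  a_lt_b : a < b
  r_pos : ∀ᵐ x ∂volume.restrict (Ioo a b), 0 < r x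
  r_integrable : IntegrableOn r (Ioo a b)
  p_pos : ∀ᵐ x ∂volume.restrict (Ioo a b), 0 < p x
  p_inv_integrable : IntegrableOn (fun x => 1 / p x) (Ioo a b)
  q_integrable : IntegrableOn q (Ioo a b)

namespace Coeff

variable (S : Coeff)

/-- The measure `r dx` on `(a, b)`. -/
def μ : Measure ℝ :=
  (volume.restrict (Ioo S.a S.b)).withDensity (fun x => ENNReal.ofReal (S.r x))

/-- The Hilbert space `L²((a, b); r dx)`. -/
abbrev L2 : Type := Lp ℂ 2 S.μ

theorem ae_of_ae_μ {P : ℝ → Prop} (h : ∀ᵐ x ∂S.μ, P x) :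
    ∀ᵐ x ∂volume.restrict (Ioo S.a S.b), P x := by
  have h' := (ae_withDensity_iff' (S.r_integrable.aestronglyMeasurable.aemeasurable.ennreal_ofReal)).1 h
  filter_upwards [h', S.r_pos] with x hx hr
  exact hx (by simpa using hr)

theorem ae_μ_of_ae {P : ℝ → Prop} (h : ∀ᵐ x ∂volume.restrict (Ioo S.a S.b), P x) :
    ∀ᵐ x ∂S.μ, P x :=
  (withDensity_absolutelyContinuous _ _).ae_le h

theorem ae_differentiableAt_of_ac {u : ℝ → ℂ} (hu : AbsolutelyContinuousOnInterval u S.a S.b) :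
    ∀ᵐ x ∂volume.restrict (Ioo S.a S.b), DifferentiableAt ℝ u x := by
  rw [ae_restrict_iff' measurableSet_Ioo]
  filter_upwards [hu.boundedVariationOn.ae_differentiableAt_of_mem_uIcc] with x hx hxI
  exact hx (Ioo_subset_Icc_self.trans Icc_subset_uIcc hxI)

/-- The space of all pairs `w = (u, u^{[1]})` with `u, u^{[1]} ∈ AC([a, b])`, where
`u^{[1]} = p u'` a.e. on `(a, b)`. -/
def acPairs : Submodule ℂ ((ℝ → ℂ) × (ℝ → ℂ)) where
  carrier := {w | AbsolutelyContinuousOnInterval w.1 S.a S.b ∧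
    AbsolutelyContinuousOnInterval w.2 S.a S.b ∧
    ∀ᵐ x ∂volume.restrict (Ioo S.a S.b), w.2 x = S.p x * deriv w.1 x}
  zero_mem' := by
    have h0 : AbsolutelyContinuousOnInterval (0 : ℝ → ℂ) S.a S.b := by
      have := (LipschitzWith.const' (α := ℝ) (0 : ℂ) (K := 0)).lipschitzOnWith (s := uIcc S.a S.b)
      exact this.absolutelyContinuousOnInterval
    refine ⟨h0, h0, Filter.Eventually.of_forall fun x => ?_⟩
    simp
  add_mem' := by
    rintro w w' ⟨h1, h2, h3⟩ ⟨h1', h2', h3'⟩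
    refine ⟨h1.add h1', h2.add h2', ?_⟩
    filter_upwards [h3, h3', S.ae_differentiableAt_of_ac h1, S.ae_differentiableAt_of_ac h1']
      with x e e' d d'
    simp only [Prod.snd_add, Prod.fst_add, Pi.add_apply]
    rw [e, e', deriv_add d d']
    ring
  smul_mem' := by
    rintro c w ⟨h1, h2, h3⟩
    refine ⟨h1.const_smul c, h2.const_smul c, ?_⟩
    filter_upwards [h3, S.ae_differentiableAt_of_ac h1] with x e d
    simp only [Prod.smul_snd, Prod.smul_fst, Pi.smul_apply, smul_eq_mul]
    rw [e, deriv_const_smul c d, smul_eq_mul]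
    ring

/-- `τ u = r⁻¹ [-(u^{[1]})' + q u]`, for `w = (u, u^{[1]})`. -/
def tau (w : (ℝ → ℂ) × (ℝ → ℂ)) (x : ℝ) : ℂ :=
  1 / (S.r x : ℂ) * (-deriv w.2 x + (S.q x : ℂ) * w.1 x)

theorem tau_add {w w' : (ℝ → ℂ) × (ℝ → ℂ)} (hw : w ∈ S.acPairs) (hw' : w' ∈ S.acPairs) :
    S.tau (w + w') =ᵐ[S.μ] S.tau w + S.tau w' := by
  apply S.ae_μ_of_ae
  filter_upwards [S.ae_differentiableAt_of_ac hw.2.1, S.ae_differentiableAt_of_ac hw'.2.1]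
    with x d d'
  simp only [tau, Prod.snd_add, Prod.fst_add, Pi.add_apply]
  rw [deriv_add d d']
  ring

theorem tau_smul (c : ℂ) {w : (ℝ → ℂ) × (ℝ → ℂ)} (hw : w ∈ S.acPairs) :
    S.tau (c • w) =ᵐ[S.μ] c • S.tau w := by
  apply S.ae_μ_of_ae
  filter_upwards [S.ae_differentiableAt_of_ac hw.2.1] with x d
  simp only [tau, Prod.smul_snd, Prod.smul_fst, Pi.smul_apply, smul_eq_mul]
  rw [deriv_const_smul c d, smul_eq_mul]
  ring

/-- The pair `w = (g, g^{[1]})` represents the class `f` in `L²((a, b); r dx)` and shows that it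
lies in the maximal domain: `g, g^{[1]} ∈ AC([a, b])`, `f = g` a.e., `τ g ∈ L²((a, b); r dx)`. -/
structure Represents (w : (ℝ → ℂ) × (ℝ → ℂ)) (f : S.L2) : Prop where
  mem : w ∈ S.acPairs
  ae_eq : f =ᵐ[S.μ] w.1
  memLp : MemLp (S.tau w) 2 S.μ

theorem Represents.add {w w' : (ℝ → ℂ) × (ℝ → ℂ)} {f f' : S.L2} (h : S.Represents w f)
    (h' : S.Represents w' f') : S.Represents (w + w') (f + f') where
  mem := add_mem h.mem h'.mem
  ae_eq := (Lp.coeFn_add f f').trans (h.ae_eq.add h'.ae_eq)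
  memLp := (h.memLp.add h'.memLp).ae_eq (S.tau_add h.mem h'.mem).symm

theorem Represents.smul (c : ℂ) {w : (ℝ → ℂ) × (ℝ → ℂ)} {f : S.L2} (h : S.Represents w f) :
    S.Represents (c • w) (c • f) where
  mem := S.acPairs.smul_mem c h.mem
  ae_eq := (Lp.coeFn_smul c f).trans (h.ae_eq.const_smul c)
  memLp := (h.memLp.const_smul c).ae_eq (S.tau_smul c h.mem).symm

theorem eqOn_of_ae {u v : ℝ → ℂ} (hu : AbsolutelyContinuousOnInterval u S.a S.b)
    (hv : AbsolutelyContinuousOnInterval v S.a S.b)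
    (h : ∀ᵐ x ∂volume.restrict (Ioo S.a S.b), u x = v x) : EqOn u v (Icc S.a S.b) := by
  have hu' := hu.continuousOn
  have hv' := hv.continuousOn
  rw [uIcc_of_le S.a_lt_b.le] at hu' hv'
  refine Measure.eqOn_Icc_of_ae_eq volume S.a_lt_b.ne ?_ hu' hv'
  rw [← Measure.restrict_congr_set Ioo_ae_eq_Icc]
  exact h

/-- The absolutely continuous representative and its quasi-derivative are unique on `[a, b]`. -/
theorem Represents.eqOn {w w' : (ℝ → ℂ) × (ℝ → ℂ)} {f : S.L2} (h : S.Represents w f)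
    (h' : S.Represents w' f) :
    EqOn w.1 w'.1 (Icc S.a S.b) ∧ EqOn w.2 w'.2 (Icc S.a S.b) := by
  have h1 : EqOn w.1 w'.1 (Icc S.a S.b) :=
    S.eqOn_of_ae h.mem.1 h'.mem.1 (S.ae_of_ae_μ (h.ae_eq.symm.trans h'.ae_eq))
  refine ⟨h1, S.eqOn_of_ae h.mem.2.1 h'.mem.2.1 ?_⟩
  filter_upwards [h.mem.2.2, h'.mem.2.2, ae_restrict_mem measurableSet_Ioo] with x e e' hx
  have : w.1 =ᶠ[nhds x] w'.1 := by
    filter_upwards [Icc_mem_nhds hx.1 hx.2] with y hy using h1 hy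
  rw [e, e', this.deriv_eq]

theorem Represents.tau_ae_eq {w w' : (ℝ → ℂ) × (ℝ → ℂ)} {f : S.L2} (h : S.Represents w f)
    (h' : S.Represents w' f) : S.tau w =ᵐ[S.μ] S.tau w' := by
  obtain ⟨h1, h2⟩ := h.eqOn S h'
  apply S.ae_μ_of_ae
  filter_upwards [ae_restrict_mem measurableSet_Ioo] with x hx
  have : w.2 =ᶠ[nhds x] w'.2 := by
    filter_upwards [Icc_mem_nhds hx.1 hx.2] with y hy using h2 hy
  simp only [tau]
  rw [h1 (Ioo_subset_Icc_self hx), this.deriv_eq]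

/-- The domain of the maximal operator. -/
def maxDomain : Submodule ℂ S.L2 where
  carrier := {f | ∃ w, S.Represents w f}
  zero_mem' := by
    refine ⟨0, S.acPairs.zero_mem, Lp.coeFn_zero ℂ 2 S.μ, ?_⟩
    have : S.tau 0 = 0 := by
      funext x
      simp [tau]
    rw [this]
    exact MemLp.zero
  add_mem' := fun ⟨_, h⟩ ⟨_, h'⟩ => ⟨_, h.add S h'⟩
  smul_mem' := fun c _ ⟨_, h⟩ => ⟨_, h.smul S c⟩

/-- The pair `(g, g^{[1]})` formed by the absolutely continuous representative `g` of an element of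
the maximal domain and its quasi-derivative (uniquely determined on `[a, b]`). -/
def repr (f : S.maxDomain) : (ℝ → ℂ) × (ℝ → ℂ) := Classical.choose f.2

theorem represents_repr (f : S.maxDomain) : S.Represents (S.repr f) f :=
  Classical.choose_spec f.2

/-- The maximal operator `H_max f = τ f`. -/
def Hmax : S.L2 →ₗ.[ℂ] S.L2 where
  domain := S.maxDomain
  toFun :=
    { toFun := fun f => (S.represents_repr f).memLp.toLp (S.tau (S.repr f))
      map_add' := fun f g => by
        have hf := S.represents_repr f
        have hg := S.represents_repr g
        rw [← MemLp.toLp_add hf.memLp hg.memLp]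
        refine MemLp.toLp_congr _ _ ?_
        exact ((S.represents_repr (f + g)).tau_ae_eq S (hf.add S hg)).trans
          (S.tau_add hf.mem hg.mem)
      map_smul' := fun c f => by
        have hf := S.represents_repr f
        rw [RingHom.id_apply, ← MemLp.toLp_const_smul c hf.memLp]
        refine MemLp.toLp_congr _ _ ?_
        exact ((S.represents_repr (c • f)).tau_ae_eq S (hf.smul S c)).trans
          (S.tau_smul c hf.mem) }

theorem traceAB_congr (A B : Matrix (Fin 2) (Fin 2) ℂ) {w w' : (ℝ → ℂ) × (ℝ → ℂ)} {f : S.L2}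
    (h : S.Represents w f) (h' : S.Represents w' f) :
    traceAB S.a S.b A B w = traceAB S.a S.b A B w' := by
  obtain ⟨h1, h2⟩ := h.eqOn S h'
  have ha : S.a ∈ Icc S.a S.b := left_mem_Icc.2 S.a_lt_b.le
  have hb : S.b ∈ Icc S.a S.b := right_mem_Icc.2 S.a_lt_b.le
  simp [traceAB, evalPair, h1 ha, h1 hb, h2 ha, h2 hb]

/-- The boundary trace `γ_{A,B}` on the maximal domain. -/
def γ (A B : Matrix (Fin 2) (Fin 2) ℂ) : S.maxDomain →ₗ[ℂ] EuclideanSpace ℂ (Fin 2) where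
  toFun f := traceAB S.a S.b A B (S.repr f)
  map_add' f g := by
    rw [← map_add]
    exact S.traceAB_congr A B (S.represents_repr (f + g))
      ((S.represents_repr f).add S (S.represents_repr g))
  map_smul' c f := by
    rw [RingHom.id_apply, ← map_smul]
    exact S.traceAB_congr A B (S.represents_repr (c • f)) ((S.represents_repr f).smul S c)

/-- The complementary boundary trace `γ⊥_{A,B}` on the maximal domain. -/
def γPerp (A B : Matrix (Fin 2) (Fin 2) ℂ) (f : S.maxDomain) : EuclideanSpace ℂ (Fin 2) :=
  tracePerp S.a S.b A B (S.repr f)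

/-- The operator `H_{A,B}`: the restriction of `H_max` to all `g ∈ dom(H_max)` with
`γ_{A,B} g = 0`. -/
def H (A B : Matrix (Fin 2) (Fin 2) ℂ) : S.L2 →ₗ.[ℂ] S.L2 :=
  S.Hmax.domRestrict ((LinearMap.ker (S.γ A B)).map S.maxDomain.subtype)

/-- The element `(H_{A,B} - z I)⁻¹ f` of `dom(H_{A,B})`, regarded as an element of `dom(H_max)`. -/
def resolventMax (A B : Matrix (Fin 2) (Fin 2) ℂ) {z : ℂ} (hz : z ∈ resolventSet (S.H A B))
    (f : S.L2) : S.maxDomain :=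
  ⟨resolvent (S.H A B) hz f, ((isResolventAt_resolvent (S.H A B) hz).mem_domain f).2⟩

/-! ### The boundary value problem and the boundary data map -/

/-- `w = (u, u^{[1]})` solves `-(u^{[1]})' + q u = z r u` a.e. on `(a, b)` with
`u, u^{[1]} ∈ AC([a, b])`, subject to `γ_{A,B} u = c`. -/
structure IsBVPSolution (A B : Matrix (Fin 2) (Fin 2) ℂ) (z : ℂ) (c : EuclideanSpace ℂ (Fin 2))
    (w : (ℝ → ℂ) × (ℝ → ℂ)) : Prop where
  mem : w ∈ S.acPairs
  eqn : ∀ᵐ x ∂volume.restrict (Ioo S.a S.b),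
    -deriv w.2 x + (S.q x : ℂ) * w.1 x = z * (S.r x : ℂ) * w.1 x
  trace_eq : traceAB S.a S.b A B w = c

/-- The boundary value problem has, for all boundary data, a unique solution on `[a, b]`. -/
def BVPWellPosed (A B : Matrix (Fin 2) (Fin 2) ℂ) (z : ℂ) : Prop :=
  ∀ c : EuclideanSpace ℂ (Fin 2), ∃ w, S.IsBVPSolution A B z c w ∧
    ∀ w', S.IsBVPSolution A B z c w' →
      EqOn w'.1 w.1 (Icc S.a S.b) ∧ EqOn w'.2 w.2 (Icc S.a S.b)

open Classical in
/-- The general boundary data map `Λ_{A,B}^{A',B'}(z) : ℂ² → ℂ²`, `c ↦ γ_{A',B'} u`, where `u` is the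
solution of the boundary value problem with data `γ_{A,B} u = c` (value `0` if there is none; for
`z ∈ ρ(H_{A,B})` there is exactly one). -/
def Λ (A B A' B' : Matrix (Fin 2) (Fin 2) ℂ) (z : ℂ) (c : EuclideanSpace ℂ (Fin 2)) :
    EuclideanSpace ℂ (Fin 2) :=
  if h : ∃ w, S.IsBVPSolution A B z c w then
    traceAB S.a S.b A' B' (Classical.choose h)
  else 0

end Coeff

end SturmLiouville

end

noncomputable section

namespace SturmLiouville

/-! ### Absolutely continuous functions -/

/-! Everything follows from recognising γ⊥(H - z̄)⁻¹ as the adjoint of the Poisson operator T : c ↦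
u(z, · ; c). For g = (H - z̄)⁻¹f, Green's formula gives ⟪Tc, f⟫ = ⟪Tc, Hg⟫ - ⟪zTc, g⟫ = ⟪γTc, γ⊥g⟫ =
⟪c, γ⊥g⟫ (`Coeff.inner_H_sub_H_inner`). Thus γ⊥(H - z̄)⁻¹ = T*, which is bounded because T is
defined on ℂ², and its adjoint is T; applying γ_{A',B'} to Tc gives Λc by definition. On the kernel
of γ_{A,B} one has γ_{A',B'} = Sγ⊥ (`IsBoundaryPair.traceAB_eq_matS`), so γ_{A',B'}(H - z̄)⁻¹ = ST*
with adjoint TS*, and the other formula follows.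

The matrix input is that, for an admissible pair, (D N; -N D) is invertible with an explicit inverse
(`boundary_matrix_identities`). The analytic input is the initial value problem with merely
integrable coefficients (`exists_linear_system_solution`). It supplies two solutions, independent by
their initial data, so injectivity of H - z makes γ_{A,B} bijective on their span, and the boundary
value problem is well posed. The same argument shows that injectivity of H - z already forces
surjectivity. Since H is symmetric, the adjoint of the resolvent at z is a left inverse of H - z̄,
hence the resolvent at z̄. -/

theorem absolutelyContinuousOnInterval_const {F : Type*} [NormedAddCommGroup F] (c : F) (a b : ℝ) :
    AbsolutelyContinuousOnInterval (fun _ : ℝ => c) a b :=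
  ((LipschitzWith.const' (α := ℝ) c (K := 0)).lipschitzOnWith
    (s := uIcc a b)).absolutelyContinuousOnInterval

theorem _root_.AbsolutelyContinuousOnInterval.ofReal {f : ℝ → ℝ} {a b : ℝ}
    (hf : AbsolutelyContinuousOnInterval f a b) :
    AbsolutelyContinuousOnInterval (fun x => (f x : ℂ)) a b := by
  have h := hf.fun_smul (absolutelyContinuousOnInterval_const (1 : ℂ) a b)
  simpa using h

theorem _root_.AbsolutelyContinuousOnInterval.star {f : ℝ → ℂ} {a b : ℝ}
    (hf : AbsolutelyContinuousOnInterval f a b) :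
    AbsolutelyContinuousOnInterval (fun x => conj (f x)) a b := by
  rw [absolutelyContinuousOnInterval_iff] at hf ⊢
  simpa only [Complex.dist_conj_conj] using hf

theorem _root_.AbsolutelyContinuousOnInterval.fun_pow {f : ℝ → ℝ} {a b : ℝ}
    (hf : AbsolutelyContinuousOnInterval f a b) (n : ℕ) :
    AbsolutelyContinuousOnInterval (fun x => f x ^ n) a b := by
  induction n with
  | zero => simpa using absolutelyContinuousOnInterval_const (1 : ℝ) a b
  | succ n ih => simpa only [pow_succ] using ih.fun_mul hf

theorem _root_.AbsolutelyContinuousOnInterval.congr {f g : ℝ → ℂ} {a b : ℝ}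
    (hf : AbsolutelyContinuousOnInterval f a b) (h : EqOn f g (uIcc a b)) :
    AbsolutelyContinuousOnInterval g a b := by
  rw [absolutelyContinuousOnInterval_iff] at hf ⊢
  intro ε hε
  obtain ⟨δ, hδ, H⟩ := hf ε hε
  refine ⟨δ, hδ, fun E hE hlen => ?_⟩
  convert H E hE hlen using 1
  refine Finset.sum_congr rfl fun i hi => ?_
  have hm := hE.1 i hi
  rw [h hm.1, h hm.2]

/-- Reduces to real-valued primitives by splitting into real and imaginary parts. -/
theorem absolutelyContinuousOnInterval_integral {f : ℝ → ℂ} {a b : ℝ}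
    (hf : IntervalIntegrable f volume a b) :
    AbsolutelyContinuousOnInterval (fun x => ∫ t in a..x, f t) a b := by
  have hre : IntervalIntegrable (fun t => (f t).re) volume a b := ⟨hf.1.re, hf.2.re⟩
  have him : IntervalIntegrable (fun t => (f t).im) volume a b := ⟨hf.1.im, hf.2.im⟩
  have h1 := (hre.absolutelyContinuousOnInterval_intervalIntegral left_mem_uIcc).ofReal
  have h2 := (him.absolutelyContinuousOnInterval_intervalIntegral left_mem_uIcc).ofReal
  refine (h1.fun_add (h2.const_smul Complex.I)).congr fun x hx => ?_
  have hfx := hf.mono_set (uIcc_subset_uIcc_left hx)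
  have e1 := intervalIntegral.intervalIntegral_re hfx
  have e2 := intervalIntegral.intervalIntegral_im hfx
  simp only [RCLike.re_to_complex, RCLike.im_to_complex] at e1 e2
  apply Complex.ext <;> simp [e1, e2]

/-- The fundamental theorem of calculus for absolutely continuous complex-valued functions. -/
theorem _root_.AbsolutelyContinuousOnInterval.integral_eq_sub {F f : ℝ → ℂ} {a b : ℝ} (hab : a ≤ b)
    (hF : AbsolutelyContinuousOnInterval F a b) (hf : IntervalIntegrable f volume a b)
    (hd : ∀ᵐ x ∂volume.restrict (Ioo a b), HasDerivAt F (f x) x) :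
    ∫ x in a..b, f x = F b - F a := by
  -- F minus the primitive of f is absolutely continuous with derivative zero a.e., hence constant.
  obtain ⟨C, hC⟩ := (hF.fun_sub
    (absolutelyContinuousOnInterval_integral hf)).const_of_ae_hasDerivAt_zero (by
      rw [Measure.restrict_congr_set Ioo_ae_eq_Icc, ae_restrict_iff' measurableSet_Icc] at hd
      filter_upwards [hd, hf.ae_hasDerivAt_integral] with x h1 h2 hx
      simpa using! (h1 (by rwa [uIcc_of_le hab] at hx)).sub (h2 hx a left_mem_uIcc))
  have ha := hC a left_mem_uIcc
  have hb := hC b right_mem_uIcc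
  simp only [intervalIntegral.integral_same, sub_zero] at ha
  rw [ha, ← hb]
  ring

/-- With m the primitive of k, m ^ (n + 1) is absolutely continuous and has a.e. derivative (n + 1)
k m ^ n. This produces the factorials in the Picard estimate. -/
theorem integral_mul_primitive_pow {k : ℝ → ℝ} {a x : ℝ}
    (hk : IntervalIntegrable k volume a x) (n : ℕ) :
    ∫ t in a..x, k t * (∫ s in a..t, k s) ^ n = (∫ s in a..x, k s) ^ (n + 1) / (n + 1) := by
  have hm := hk.absolutelyContinuousOnInterval_intervalIntegral (c := a) left_mem_uIcc
  have h := (hm.fun_pow (n + 1)).integral_deriv_eq_sub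
  simp only [intervalIntegral.integral_same, ne_eq, Nat.add_eq_zero_iff, one_ne_zero, and_false,
    not_false_eq_true, zero_pow, sub_zero] at h
  rw [← h, eq_div_iff (by positivity), ← intervalIntegral.integral_mul_const]
  refine intervalIntegral.integral_congr_ae ?_
  filter_upwards [hk.ae_hasDerivAt_integral] with t ht hmem
  have := (ht (uIoc_subset_uIcc hmem) a left_mem_uIcc).pow (n + 1)
  refine Eq.trans ?_ (HasDerivAt.deriv this).symm
  push_cast
  ring

/-! ### Linear systems with integrable coefficients -/

section LinearSystem

variable {a b : ℝ} {P Q g : ℝ → ℂ}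

/-- The integral operator whose fixed points solve `u' = P v`, `v' = Q u + g`,
`u(a) = α`, `v(a) = β`. -/
def picardMap (hab : a ≤ b) (hP : IntervalIntegrable P volume a b)
    (hQ : IntervalIntegrable Q volume a b) (hg : IntervalIntegrable g volume a b) (α β : ℂ)
    (y : C(Icc a b, ℂ × ℂ)) : C(Icc a b, ℂ × ℂ) where
  toFun x := (α + ∫ t in a..x, P t * (IccExtend hab y t).2,
    β + ∫ t in a..x, (Q t * (IccExtend hab y t).1 + g t))
  continuous_toFun := by
    have hy : Continuous (IccExtend hab y) := y.continuous.Icc_extend'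
    have h1 := (hP.mul_continuousOn hy.snd.continuousOn)
    have h2 := ((hQ.mul_continuousOn hy.fst.continuousOn).add hg)
    have c1 := (absolutelyContinuousOnInterval_integral h1).continuousOn
    have c2 := (absolutelyContinuousOnInterval_integral h2).continuousOn
    rw [uIcc_of_le hab] at c1 c2
    exact (continuous_const.add (continuousOn_iff_continuous_domRestrict.1 c1)).prodMk
      (continuous_const.add (continuousOn_iff_continuous_domRestrict.1 c2))

/-- The coefficients need not be bounded, so the primitive of ‖P‖ + ‖Q‖ replaces the usual Lipschitz
constant times x - a. In the induction each component is dominated using this one weight, because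
the product carries the sup distance and g cancels in differences. -/
theorem dist_picardMap_iterate_le (hab : a ≤ b) (hP : IntervalIntegrable P volume a b)
    (hQ : IntervalIntegrable Q volume a b) (hg : IntervalIntegrable g volume a b) (α β : ℂ)
    (y y' : C(Icc a b, ℂ × ℂ)) (n : ℕ) (x : Icc a b) :
    dist ((picardMap hab hP hQ hg α β)^[n] y x) ((picardMap hab hP hQ hg α β)^[n] y' x) ≤
      (∫ t in a..x, (‖P t‖ + ‖Q t‖)) ^ n / n.factorial * dist y y' := by
  induction n generalizing x with
  | zero => simpa using ContinuousMap.dist_apply_le_dist x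
  | succ n ih =>
    rw [Function.iterate_succ_apply', Function.iterate_succ_apply']
    set Y := (picardMap hab hP hQ hg α β)^[n] y
    set Y' := (picardMap hab hP hQ hg α β)^[n] y'
    have hY : Continuous (IccExtend hab Y) := Y.continuous.Icc_extend'
    have hY' : Continuous (IccExtend hab Y') := Y'.continuous.Icc_extend'
    have hsub : uIcc a x ⊆ uIcc a b := by
      rw [uIcc_of_le x.2.1, uIcc_of_le hab]
      exact Icc_subset_Icc_right x.2.2
    have hPx := hP.mono_set hsub
    have hQx := hQ.mono_set hsub
    have hgx := hg.mono_set hsub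
    have hk : IntervalIntegrable (fun t => ‖P t‖ + ‖Q t‖) volume a x := hPx.norm.add hQx.norm
    have hm := (hk.absolutelyContinuousOnInterval_intervalIntegral
      (c := a) left_mem_uIcc).continuousOn
    have hint : IntervalIntegrable (fun t => (‖P t‖ + ‖Q t‖) *
        (∫ s in a..t, (‖P s‖ + ‖Q s‖)) ^ n * (1 / n.factorial * dist y y')) volume a x :=
      (hk.mul_continuousOn (hm.pow n)).mul_const _
    have hval : ∫ t in a..x, (‖P t‖ + ‖Q t‖) *
        (∫ s in a..t, (‖P s‖ + ‖Q s‖)) ^ n * (1 / n.factorial * dist y y') =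
        (∫ t in a..x, (‖P t‖ + ‖Q t‖)) ^ (n + 1) / (n + 1).factorial * dist y y' := by
      rw [intervalIntegral.integral_mul_const, integral_mul_primitive_pow hk,
        Nat.factorial_succ]
      push_cast
      have : (n.factorial : ℝ) ≠ 0 := by positivity
      field_simp
    have hd : ∀ t ∈ Ioc a (x : ℝ), dist (IccExtend hab Y t) (IccExtend hab Y' t) ≤
        (∫ s in a..t, (‖P s‖ + ‖Q s‖)) ^ n * (1 / n.factorial * dist y y') := by
      intro t ht
      have htI : t ∈ Icc a b := ⟨ht.1.le, ht.2.trans x.2.2⟩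
      rw [IccExtend_of_mem hab _ htI, IccExtend_of_mem hab _ htI]
      refine (ih ⟨t, htI⟩).trans_eq ?_
      ring
    rw [← hval, Prod.dist_eq]
    refine max_le ?_ ?_
    · change dist (α + ∫ t in a..x, P t * (IccExtend hab Y t).2)
        (α + ∫ t in a..x, P t * (IccExtend hab Y' t).2) ≤ _
      rw [dist_add_left, dist_eq_norm, ← intervalIntegral.integral_sub
        (hPx.mul_continuousOn hY.snd.continuousOn) (hPx.mul_continuousOn hY'.snd.continuousOn)]
      refine intervalIntegral.norm_integral_le_of_norm_le x.2.1
        (Filter.Eventually.of_forall fun t ht => ?_) hint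
      have h2 : ‖(IccExtend hab Y t).2 - (IccExtend hab Y' t).2‖ ≤ _ :=
        
          (norm_snd_le (IccExtend hab Y t - IccExtend hab Y' t)).trans
            ((dist_eq_norm _ _).symm.trans_le (hd t ht))
      rw [← mul_sub, norm_mul, mul_assoc]
      exact mul_le_mul (le_add_of_nonneg_right (norm_nonneg _)) h2 (norm_nonneg _) (by positivity)
    · change dist (β + ∫ t in a..x, (Q t * (IccExtend hab Y t).1 + g t))
        (β + ∫ t in a..x, (Q t * (IccExtend hab Y' t).1 + g t)) ≤ _
      rw [dist_add_left, dist_eq_norm, ← intervalIntegral.integral_sub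
        ((hQx.mul_continuousOn hY.fst.continuousOn).add hgx)
        ((hQx.mul_continuousOn hY'.fst.continuousOn).add hgx)]
      refine intervalIntegral.norm_integral_le_of_norm_le x.2.1
        (Filter.Eventually.of_forall fun t ht => ?_) hint
      have h2 : ‖(IccExtend hab Y t).1 - (IccExtend hab Y' t).1‖ ≤ _ :=
        
          (norm_fst_le (IccExtend hab Y t - IccExtend hab Y' t)).trans
            ((dist_eq_norm _ _).symm.trans_le (hd t ht))
      rw [add_sub_add_right_eq_sub, ← mul_sub, norm_mul, mul_assoc]
      exact mul_le_mul (le_add_of_nonneg_left (norm_nonneg _)) h2 (norm_nonneg _) (by positivity)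

/-- Some iterate is a contraction, and the unique fixed point of an iterate is fixed by the map
itself. -/
theorem exists_isFixedPt_picardMap (hab : a ≤ b) (hP : IntervalIntegrable P volume a b)
    (hQ : IntervalIntegrable Q volume a b) (hg : IntervalIntegrable g volume a b) (α β : ℂ) :
    ∃ y, picardMap hab hP hQ hg α β y = y := by
  set m := ∫ t in a..b, (‖P t‖ + ‖Q t‖) with hm
  -- Here m is the total mass of the weight, so m ^ n / n! bounds the Lipschitz constant of the n-th
  -- iterate uniformly in x.
  obtain ⟨n, hn⟩ := ((FloorSemiring.tendsto_pow_div_factorial_atTop m).eventually_lt_const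
    (show (0 : ℝ) < 1 / 2 by norm_num)).exists
  have hk : IntervalIntegrable (fun t => ‖P t‖ + ‖Q t‖) volume a b := hP.norm.add hQ.norm
  have hc : ContractingWith (1 / 2) (picardMap hab hP hQ hg α β)^[n] := by
    refine ⟨by rw [← NNReal.coe_lt_coe]; norm_num, LipschitzWith.of_dist_le_mul fun y y' => ?_⟩
    rw [ContinuousMap.dist_le (by positivity)]
    intro x
    refine (dist_picardMap_iterate_le hab hP hQ hg α β y y' n x).trans ?_
    have h0 : 0 ≤ ∫ t in a..x, (‖P t‖ + ‖Q t‖) :=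
      intervalIntegral.integral_nonneg x.2.1 fun t _ => by positivity
    have hle : ∫ t in a..x, (‖P t‖ + ‖Q t‖) ≤ m :=
      intervalIntegral.integral_mono_interval le_rfl x.2.1 x.2.2
        (Filter.Eventually.of_forall fun t => by simp only [Pi.zero_apply]; positivity) hk
    have : (∫ t in a..x, (‖P t‖ + ‖Q t‖)) ^ n / n.factorial ≤ m ^ n / n.factorial := by gcongr
    exact mul_le_mul_of_nonneg_right (by simpa using (this.trans hn.le)) dist_nonneg
  exact ⟨_, hc.isFixedPt_fixedPoint_iterate⟩

theorem exists_linear_system_solution (hab : a ≤ b) (hP : IntervalIntegrable P volume a b)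
    (hQ : IntervalIntegrable Q volume a b) (hg : IntervalIntegrable g volume a b) (α β : ℂ) :
    ∃ u v : ℝ → ℂ, AbsolutelyContinuousOnInterval u a b ∧ AbsolutelyContinuousOnInterval v a b ∧
      u a = α ∧ v a = β ∧ ∀ᵐ x ∂volume.restrict (Ioo a b),
        HasDerivAt u (P x * v x) x ∧ HasDerivAt v (Q x * u x + g x) x := by
  obtain ⟨y, hy⟩ := exists_isFixedPt_picardMap hab hP hQ hg α β
  have hc : Continuous (IccExtend hab y) := y.continuous.Icc_extend'
  have h1 := hP.mul_continuousOn (hc.snd.continuousOn (s := uIcc a b))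
  have h2 := (hQ.mul_continuousOn (hc.fst.continuousOn (s := uIcc a b))).add hg
  have hval : ∀ x ∈ Icc a b, IccExtend hab y x =
      (α + ∫ t in a..x, P t * (IccExtend hab y t).2,
        β + ∫ t in a..x, (Q t * (IccExtend hab y t).1 + g t)) := by
    intro x hx
    conv_lhs => rw [IccExtend_of_mem hab _ hx, ← hy]
    rfl
  -- The integral formulas, rather than y itself, are taken as the solution: they are visibly
  -- absolutely continuous, agree with y on [a, b], and are differentiable a.e. by Lebesgue
  -- differentiation.
  refine ⟨fun x => α + ∫ t in a..x, P t * (IccExtend hab y t).2,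
    fun x => β + ∫ t in a..x, (Q t * (IccExtend hab y t).1 + g t),
    (absolutelyContinuousOnInterval_const α a b).fun_add
      (absolutelyContinuousOnInterval_integral h1),
    (absolutelyContinuousOnInterval_const β a b).fun_add
      (absolutelyContinuousOnInterval_integral h2), by simp, by simp, ?_⟩
  rw [ae_restrict_iff' measurableSet_Ioo]
  filter_upwards [h1.ae_hasDerivAt_integral, h2.ae_hasDerivAt_integral] with x d1 d2 hx
  have hxI := Ioo_subset_Icc_self hx
  have hxu : x ∈ uIcc a b := by rwa [uIcc_of_le hab]
  have e1 := congrArg Prod.fst (hval x hxI)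
  have e2 := congrArg Prod.snd (hval x hxI)
  simp only at e1 e2
  rw [← e1, ← e2]
  exact ⟨(d1 hxu a left_mem_uIcc).const_add α, (d2 hxu a left_mem_uIcc).const_add β⟩

end LinearSystem

/-! ### Boundary pairs and boundary traces -/

section Matrices

variable {A B : Matrix (Fin 2) (Fin 2) ℂ}

/-- Entry by entry this is AJA* = BJB*, with the columns of A and B regrouped by endpoint value and
quasi-derivative. -/
theorem IsBoundaryPair.matN_mul_conjTranspose (h : IsBoundaryPair A B) :
    matN A B * (matD A B)ᴴ = matD A B * (matN A B)ᴴ := by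
  have hs := h.symplectic
  rw [← Matrix.ext_iff] at hs ⊢
  intro i j
  have := hs i j
  fin_cases i <;> fin_cases j <;>
    simp [matN, matD, symplecticJ, Matrix.mul_apply, Fin.sum_univ_two] at this ⊢ <;>
    linear_combination this

open scoped ComplexOrder in
-- The columns of D and N are those of A and B up to order and sign, so this is the Gram matrix of
-- (A B), whose rank is 2.
theorem IsBoundaryPair.isUnit_gram (h : IsBoundaryPair A B) :
    IsUnit (matD A B * (matD A B)ᴴ + matN A B * (matN A B)ᴴ) := by
  have e : matD A B * (matD A B)ᴴ + matN A B * (matN A B)ᴴ =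
      Matrix.fromCols A B * (Matrix.fromCols A B)ᴴ := by
    rw [Matrix.conjTranspose_fromCols_eq_fromRows_conjTranspose, Matrix.fromCols_mul_fromRows]
    ext i j
    simp only [Matrix.add_apply, Matrix.mul_apply, Fin.sum_univ_two, Matrix.conjTranspose_apply]
    fin_cases i <;> fin_cases j <;> simp [matN, matD] <;> ring
  have hr := h.rank_eq
  rw [← Matrix.rank_self_mul_conjTranspose, ← e] at hr
  rw [← Matrix.linearIndependent_rows_iff_isUnit, linearIndependent_iff_card_eq_finrank_span,
    Set.finrank, ← Matrix.rank_eq_finrank_span_row, hr, Fintype.card_fin]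

/-- The inverse of `(D N; -N D)` is `(D* -N*; N* D*)` times the inverse Gram matrix. -/
theorem boundary_matrix_identities {n : Type*} [Fintype n] [DecidableEq n] {D N : Matrix n n ℂ}
    (hc : N * Dᴴ = D * Nᴴ) (hu : IsUnit (D * Dᴴ + N * Nᴴ)) :
    Dᴴ * ((D * Dᴴ + N * Nᴴ)⁻¹ * D) + Nᴴ * ((D * Dᴴ + N * Nᴴ)⁻¹ * N) = 1 ∧
    Dᴴ * ((D * Dᴴ + N * Nᴴ)⁻¹ * N) = Nᴴ * ((D * Dᴴ + N * Nᴴ)⁻¹ * D) := by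
  set M := D * Dᴴ + N * Nᴴ with hM
  have hdet := (Matrix.isUnit_iff_isUnit_det _).1 hu
  have h1 : Matrix.fromBlocks D N (-N) D *
      (Matrix.fromBlocks (Dᴴ * M⁻¹) (-(Nᴴ * M⁻¹)) (Nᴴ * M⁻¹) (Dᴴ * M⁻¹)) = 1 := by
    rw [Matrix.fromBlocks_multiply, ← Matrix.fromBlocks_one]
    have e1 : D * (Dᴴ * M⁻¹) + N * (Nᴴ * M⁻¹) = 1 := by
      rw [← Matrix.mul_assoc, ← Matrix.mul_assoc, ← Matrix.add_mul, ← hM,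
        Matrix.mul_nonsing_inv _ hdet]
    have e2 : N * (Dᴴ * M⁻¹) = D * (Nᴴ * M⁻¹) := by
      rw [← Matrix.mul_assoc, ← Matrix.mul_assoc, hc]
    congr 1
    · rw [Matrix.mul_neg, e2, neg_add_cancel]
    · rw [Matrix.neg_mul, e2, neg_add_cancel]
    · rw [Matrix.neg_mul, Matrix.mul_neg, neg_neg, add_comm, e1]
  -- A right inverse of a square matrix is a left inverse; the first block row of the reversed
  -- product gives both identities.
  have h2 := mul_eq_one_comm.1 h1
  rw [Matrix.fromBlocks_multiply, ← Matrix.fromBlocks_one, Matrix.fromBlocks_inj] at h2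
  obtain ⟨h11, h12, -, -⟩ := h2
  simp only [Matrix.neg_mul, Matrix.mul_neg, neg_neg, Matrix.mul_assoc] at h11 h12
  exact ⟨h11, by rwa [← sub_eq_add_neg, sub_eq_zero] at h12⟩

theorem traceAB_eq (a b : ℝ) (A B : Matrix (Fin 2) (Fin 2) ℂ) (w : (ℝ → ℂ) × (ℝ → ℂ)) :
    traceAB a b A B w = Matrix.toEuclideanLin (matD A B) (traceD a b w) +
      Matrix.toEuclideanLin (matN A B) (traceN a b w) := by
  ext i
  fin_cases i <;>
    simp [traceAB, traceD, traceN, evalPair, matD, matN, Matrix.toLpLin_apply] <;> ring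

theorem toEuclideanLin_mul_apply (X Y : Matrix (Fin 2) (Fin 2) ℂ) (v : EuclideanSpace ℂ (Fin 2)) :
    Matrix.toEuclideanLin (X * Y) v = Matrix.toEuclideanLin X (Matrix.toEuclideanLin Y v) := by
  rw [Matrix.toLpLin_mul_same, LinearMap.comp_apply]

theorem inner_toEuclideanLin_conjTranspose (X : Matrix (Fin 2) (Fin 2) ℂ)
    (v w : EuclideanSpace ℂ (Fin 2)) :
    ⟪v, Matrix.toEuclideanLin Xᴴ w⟫_ℂ = ⟪Matrix.toEuclideanLin X v, w⟫_ℂ := by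
  rw [Matrix.toEuclideanLin_conjTranspose_eq_adjoint, LinearMap.adjoint_inner_right]

theorem toEuclideanLin_conjTranspose_inner (X : Matrix (Fin 2) (Fin 2) ℂ)
    (v w : EuclideanSpace ℂ (Fin 2)) :
    ⟪Matrix.toEuclideanLin Xᴴ v, w⟫_ℂ = ⟪v, Matrix.toEuclideanLin X w⟫_ℂ := by
  rw [Matrix.toEuclideanLin_conjTranspose_eq_adjoint, LinearMap.adjoint_inner_left]

/-- `γ_D = -N* γ⊥` and `γ_N = D* γ⊥` on the kernel of `γ_{A,B}`. -/
theorem IsBoundaryPair.traces_of_traceAB_eq_zero (h : IsBoundaryPair A B) {a b : ℝ}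
    {w : (ℝ → ℂ) × (ℝ → ℂ)} (hw : traceAB a b A B w = 0) :
    traceD a b w = -Matrix.toEuclideanLin (matN A B)ᴴ (tracePerp a b A B w) ∧
    traceN a b w = Matrix.toEuclideanLin (matD A B)ᴴ (tracePerp a b A B w) := by
  obtain ⟨h1, h2⟩ := boundary_matrix_identities h.matN_mul_conjTranspose h.isUnit_gram
  set D := matD A B
  set N := matN A B
  set K := (D * Dᴴ + N * Nᴴ)⁻¹ with hK
  have hP : tracePerp a b A B w = -Matrix.toEuclideanLin (K * N) (traceD a b w) +
      Matrix.toEuclideanLin (K * D) (traceN a b w) := by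
    simp [tracePerp, matDPerp, matNPerp, ← hK, D, N]
  have h0 : Matrix.toEuclideanLin (K * D) (traceD a b w) +
      Matrix.toEuclideanLin (K * N) (traceN a b w) = 0 := by
    rw [toEuclideanLin_mul_apply, toEuclideanLin_mul_apply, ← map_add, ← traceAB_eq, hw, map_zero]
  have hone : ∀ v, Matrix.toEuclideanLin Dᴴ (Matrix.toEuclideanLin (K * D) v) +
      Matrix.toEuclideanLin Nᴴ (Matrix.toEuclideanLin (K * N) v) = v := by
    intro v
    rw [← toEuclideanLin_mul_apply, ← toEuclideanLin_mul_apply, ← LinearMap.add_apply, ← map_add,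
      h1]
    simp
  have hsw : ∀ v, Matrix.toEuclideanLin Dᴴ (Matrix.toEuclideanLin (K * N) v) =
      Matrix.toEuclideanLin Nᴴ (Matrix.toEuclideanLin (K * D) v) := by
    intro v
    rw [← toEuclideanLin_mul_apply, ← toEuclideanLin_mul_apply, h2]
  -- Applying D* and N* to Kγ_{A,B}w = 0 and using `hsw` trades D*KDγ_D for -N*KDγ_N and N*KNγ_N for
  -- -D*KNγ_D in the expansions given by `hone`.
  have hD0 := congrArg (Matrix.toEuclideanLin Dᴴ) h0
  have hN0 := congrArg (Matrix.toEuclideanLin Nᴴ) h0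
  rw [map_add, map_zero, hsw] at hD0
  rw [map_add, map_zero, ← hsw] at hN0
  rw [hP, map_add, map_add, map_neg, map_neg]
  constructor
  · refine (hone (traceD a b w)).symm.trans ?_
    rw [eq_neg_of_add_eq_zero_left hD0]
    abel
  · refine (hone (traceN a b w)).symm.trans ?_
    rw [eq_neg_of_add_eq_zero_right hN0]
    abel

/-- `γ_{A',B'} = S_{A',B',A,B} γ⊥_{A,B}` on the kernel of `γ_{A,B}`. -/
theorem IsBoundaryPair.traceAB_eq_matS (h : IsBoundaryPair A B) {a b : ℝ}
    {w : (ℝ → ℂ) × (ℝ → ℂ)} (hw : traceAB a b A B w = 0) (A' B' : Matrix (Fin 2) (Fin 2) ℂ) :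
    traceAB a b A' B' w = Matrix.toEuclideanLin (matS A' B' A B) (tracePerp a b A B w) := by
  obtain ⟨h1, h2⟩ := h.traces_of_traceAB_eq_zero hw
  rw [traceAB_eq, h1, h2, matS, map_sub, LinearMap.sub_apply, toEuclideanLin_mul_apply,
    toEuclideanLin_mul_apply, map_neg]
  abel

/-- The boundary form pairs `γ_{A,B}` with `γ⊥_{A,B}` on the kernel of `γ_{A,B}`. -/
theorem IsBoundaryPair.boundary_form (h : IsBoundaryPair A B) {a b : ℝ}
    {v w : (ℝ → ℂ) × (ℝ → ℂ)} (hw : traceAB a b A B w = 0) :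
    ⟪traceD a b v, traceN a b w⟫_ℂ - ⟪traceN a b v, traceD a b w⟫_ℂ =
      ⟪traceAB a b A B v, tracePerp a b A B w⟫_ℂ := by
  obtain ⟨h1, h2⟩ := h.traces_of_traceAB_eq_zero hw
  rw [h1, h2, inner_neg_right, inner_toEuclideanLin_conjTranspose,
    inner_toEuclideanLin_conjTranspose, traceAB_eq, inner_add_left, sub_neg_eq_add]

end Matrices

/-! ### Green's formula -/

namespace Coeff

variable (S : Coeff)

theorem aemeasurable_r :
    AEMeasurable (fun x => ENNReal.ofReal (S.r x)) (volume.restrict (Ioo S.a S.b)) :=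
  S.r_integrable.aestronglyMeasurable.aemeasurable.ennreal_ofReal

theorem integrable_μ_iff {f : ℝ → ℂ} :
    Integrable f S.μ ↔ IntegrableOn (fun x => (S.r x : ℂ) * f x) (Ioo S.a S.b) := by
  rw [μ, integrable_withDensity_iff_integrable_smul₀' S.aemeasurable_r (by simp)]
  refine integrable_congr ?_
  filter_upwards [S.r_pos] with x hx
  rw [ENNReal.toReal_ofReal hx.le, Complex.real_smul]

theorem integral_μ (f : ℝ → ℂ) :
    ∫ x, f x ∂S.μ = ∫ x in S.a..S.b, (S.r x : ℂ) * f x := by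
  rw [μ, integral_withDensity_eq_integral_toReal_smul₀ S.aemeasurable_r (by simp),
    intervalIntegral.integral_of_le S.a_lt_b.le, integral_Ioc_eq_integral_Ioo]
  refine integral_congr_ae ?_
  filter_upwards [S.r_pos] with x hx
  rw [ENNReal.toReal_ofReal hx.le, Complex.real_smul]

/-- Lagrange's identity: after multiplication by r the integrand is the a.e. derivative of
conj(u^{[1]}) v - conj(u) v^{[1]}, where the q terms and the p terms cancel because q and p are
real. The sign at b in γ_N matches the difference of endpoint values. -/
theorem inner_sub_inner_eq_traces {w w' : (ℝ → ℂ) × (ℝ → ℂ)} {f f' h h' : S.L2}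
    (hf : S.Represents w f) (hf' : S.Represents w' f') (hh : h =ᵐ[S.μ] S.tau w)
    (hh' : h' =ᵐ[S.μ] S.tau w') :
    ⟪f, h'⟫_ℂ - ⟪h, f'⟫_ℂ = ⟪traceD S.a S.b w, traceN S.a S.b w'⟫_ℂ -
      ⟪traceN S.a S.b w, traceD S.a S.b w'⟫_ℂ := by
  have hint := (L2.integrable_inner (𝕜 := ℂ) f h').sub (L2.integrable_inner (𝕜 := ℂ) h f')
  rw [L2.inner_def, L2.inner_def, ← integral_sub (L2.integrable_inner f h')
    (L2.integrable_inner h f'), S.integral_μ]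
  change Integrable (fun x => ⟪f x, h' x⟫_ℂ - ⟪h x, f' x⟫_ℂ) S.μ at hint
  rw [S.integrable_μ_iff, ← intervalIntegrable_iff_integrableOn_Ioo_of_le S.a_lt_b.le] at hint
  have hac := (hf.mem.2.1.star.fun_smul hf'.mem.1).fun_sub (hf.mem.1.star.fun_smul hf'.mem.2.1)
  rw [hac.integral_eq_sub S.a_lt_b.le hint ?_]
  · simp [traceD, traceN, PiLp.inner_apply, Fin.sum_univ_two]
    ring
  · filter_upwards [S.ae_of_ae_μ hf.ae_eq, S.ae_of_ae_μ hf'.ae_eq, S.ae_of_ae_μ hh,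
      S.ae_of_ae_μ hh', S.ae_differentiableAt_of_ac hf.mem.1,
      S.ae_differentiableAt_of_ac hf.mem.2.1, S.ae_differentiableAt_of_ac hf'.mem.1,
      S.ae_differentiableAt_of_ac hf'.mem.2.1, hf.mem.2.2, hf'.mem.2.2, S.r_pos, S.p_pos]
      with x e1 e2 e3 e4 d1 d2 d3 d4 q1 q2 hr hp
    have hr' : (S.r x : ℂ) ≠ 0 := by exact_mod_cast hr.ne'
    have hD := (d2.hasDerivAt.star.mul d3.hasDerivAt).sub (d1.hasDerivAt.star.mul d4.hasDerivAt)
    refine (hD.congr_deriv ?_ : HasDerivAt _ _ _)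
    rw [e1, e2, e3, e4]
    simp only [RCLike.inner_apply, tau, q1, q2, RCLike.star_def, map_mul, map_add, map_neg, map_div₀,
      map_one, Complex.conj_ofReal]
    field_simp
    ring

end Coeff

/-- The linear map `ℂ² → V`, `d ↦ d₀ x + d₁ y`. -/
def linearComb {V : Type*} [AddCommGroup V] [Module ℂ V] (x y : V) :
    EuclideanSpace ℂ (Fin 2) →ₗ[ℂ] V where
  toFun d := d 0 • x + d 1 • y
  map_add' d d' := by simp only [PiLp.add_apply]; module
  map_smul' c d := by simp only [PiLp.smul_apply, smul_eq_mul, mul_smul, smul_add, RingHom.id_apply]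

theorem linearComb_apply {V : Type*} [AddCommGroup V] [Module ℂ V] (x y : V)
    (d : EuclideanSpace ℂ (Fin 2)) : linearComb x y d = d 0 • x + d 1 • y := rfl

namespace Coeff

variable (S : Coeff)

/-! ### The inhomogeneous equation -/

instance : IsFiniteMeasure S.μ :=
  isFiniteMeasure_withDensity_ofReal S.r_integrable.2

theorem memLp_of_ac {u : ℝ → ℂ} (hu : AbsolutelyContinuousOnInterval u S.a S.b) :
    MemLp u 2 S.μ := by
  obtain ⟨C, hC⟩ := hu.exists_bound
  have hc := hu.continuousOn
  rw [uIcc_of_le S.a_lt_b.le] at hC hc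
  refine MemLp.of_bound (((hc.mono Ioo_subset_Icc_self).aestronglyMeasurable
    measurableSet_Ioo).mono_ac (withDensity_absolutelyContinuous _ _)) C (S.ae_μ_of_ae ?_)
  filter_upwards [ae_restrict_mem measurableSet_Ioo] with x hx
  exact hC x (Ioo_subset_Icc_self hx)

/-- The equation τu = zu + f is the first-order system u' = v / p, v' = (q - zr)u - rf. Its forcing
term is integrable since f is square integrable for a finite measure. -/
theorem exists_represents_inhomogeneous (z : ℂ) (f : S.L2) (α β : ℂ) :
    ∃ w g, S.Represents w g ∧ w.1 S.a = α ∧ w.2 S.a = β ∧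
      S.tau w =ᵐ[S.μ] ⇑(z • g + f) := by
  have hab := S.a_lt_b.le
  have hP : IntervalIntegrable (fun x => (((1 / S.p x : ℝ)) : ℂ)) volume S.a S.b := by
    rw [intervalIntegrable_iff_integrableOn_Ioo_of_le hab]
    exact S.p_inv_integrable.ofReal
  have hQ : IntervalIntegrable (fun x => (S.q x : ℂ) - z * (S.r x : ℂ)) volume S.a S.b := by
    rw [intervalIntegrable_iff_integrableOn_Ioo_of_le hab]
    exact S.q_integrable.ofReal.sub (S.r_integrable.ofReal.const_mul z)
  have hg : IntervalIntegrable (fun x => -((S.r x : ℂ) * f x)) volume S.a S.b := by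
    rw [intervalIntegrable_iff_integrableOn_Ioo_of_le hab]
    exact (S.integrable_μ_iff.1 ((Lp.memLp f).integrable (by norm_num))).neg
  obtain ⟨u, v, hu, hv, ha, hb, hd⟩ := exists_linear_system_solution hab hP hQ hg α β
  have hmem : (u, v) ∈ S.acPairs := by
    refine ⟨hu, hv, ?_⟩
    filter_upwards [hd, S.p_pos] with x hx hp
    have hp' : (S.p x : ℂ) ≠ 0 := by exact_mod_cast hp.ne'
    rw [hx.1.deriv]
    push_cast
    field_simp
  have hL := S.memLp_of_ac hu
  have htau : S.tau (u, v) =ᵐ[S.μ] ⇑(z • hL.toLp u + f) := by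
    have h1 : ∀ᵐ x ∂S.μ, S.tau (u, v) x = z * u x + f x := by
      apply S.ae_μ_of_ae
      filter_upwards [hd, S.r_pos] with x hx hr
      have hr' : (S.r x : ℂ) ≠ 0 := by exact_mod_cast hr.ne'
      simp only [tau]
      rw [hx.2.deriv]
      field_simp
      ring
    filter_upwards [h1, Lp.coeFn_add (z • hL.toLp u) f, Lp.coeFn_smul z (hL.toLp u), hL.coeFn_toLp]
      with x e1 e2 e3 e4
    rw [e1, e2, Pi.add_apply, e3, Pi.smul_apply, e4, smul_eq_mul]
  exact ⟨(u, v), hL.toLp u, ⟨hmem, hL.coeFn_toLp, (Lp.memLp _).ae_eq htau.symm⟩, ha, hb, htau⟩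

/-- The space of solutions of `τ u = z u`. -/
def solutions (z : ℂ) : Submodule ℂ ((ℝ → ℂ) × (ℝ → ℂ)) where
  carrier := {w | w ∈ S.acPairs ∧ S.tau w =ᵐ[S.μ] z • w.1}
  zero_mem' := ⟨S.acPairs.zero_mem, Filter.Eventually.of_forall fun x => by simp [tau]⟩
  add_mem' := by
    rintro w w' ⟨h, e⟩ ⟨h', e'⟩
    refine ⟨add_mem h h', (S.tau_add h h').trans ?_⟩
    simpa only [Prod.fst_add, smul_add] using e.add e'
  smul_mem' := by
    rintro c w ⟨h, e⟩
    refine ⟨S.acPairs.smul_mem c h, (S.tau_smul c h).trans ?_⟩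
    simpa only [Prod.smul_fst, smul_comm z c] using e.const_smul c

theorem Represents.of_mem_solutions {z : ℂ} {w : (ℝ → ℂ) × (ℝ → ℂ)} (hw : w ∈ S.solutions z) :
    S.Represents w ((S.memLp_of_ac hw.1.1).toLp w.1) :=
  ⟨hw.1, MemLp.coeFn_toLp _, ((S.memLp_of_ac hw.1.1).const_smul z).ae_eq hw.2.symm⟩

theorem Represents.tau_ae_eq_smul {z : ℂ} {w : (ℝ → ℂ) × (ℝ → ℂ)} {g : S.L2}
    (hg : S.Represents w g) (hw : w ∈ S.solutions z) : ⇑(z • g) =ᵐ[S.μ] S.tau w :=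
  ((Lp.coeFn_smul z g).trans (hg.ae_eq.const_smul z)).trans hw.2.symm

theorem isBVPSolution_iff {A B : Matrix (Fin 2) (Fin 2) ℂ} {z : ℂ} {c : EuclideanSpace ℂ (Fin 2)}
    {w : (ℝ → ℂ) × (ℝ → ℂ)} :
    S.IsBVPSolution A B z c w ↔ w ∈ S.solutions z ∧ traceAB S.a S.b A B w = c := by
  have key : (∀ᵐ x ∂volume.restrict (Ioo S.a S.b),
      -deriv w.2 x + (S.q x : ℂ) * w.1 x = z * (S.r x : ℂ) * w.1 x) ↔
      S.tau w =ᵐ[S.μ] z • w.1 := by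
    have hpt : ∀ x, 0 < S.r x → ((-deriv w.2 x + (S.q x : ℂ) * w.1 x = z * (S.r x : ℂ) * w.1 x) ↔
        S.tau w x = z * w.1 x) := by
      intro x hr
      have hr' : (S.r x : ℂ) ≠ 0 := by exact_mod_cast hr.ne'
      rw [tau, one_div, inv_mul_eq_iff_eq_mul₀ hr']
      constructor <;> intro h <;> rw [h] <;> ring
    constructor
    · intro h
      apply S.ae_μ_of_ae
      filter_upwards [h, S.r_pos] with x hx hr using (hpt x hr).1 hx
    · intro h
      filter_upwards [S.ae_of_ae_μ h, S.r_pos] with x hx hr using (hpt x hr).2 hx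
  exact ⟨fun h => ⟨⟨h.mem, key.1 h.eqn⟩, h.trace_eq⟩, fun h => ⟨h.1.1, key.2 h.1.2, h.2⟩⟩

/-! ### The operator `H_{A,B}` -/

variable {A B : Matrix (Fin 2) (Fin 2) ℂ}

theorem mem_H_domain_of_represents {w : (ℝ → ℂ) × (ℝ → ℂ)} {g : S.L2} (hg : S.Represents w g)
    (hw : traceAB S.a S.b A B w = 0) : g ∈ (S.H A B).domain := by
  have hmax : g ∈ S.maxDomain := ⟨w, hg⟩
  refine ⟨⟨⟨g, hmax⟩, ?_, rfl⟩, hmax⟩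
  exact (S.traceAB_congr A B (S.represents_repr ⟨g, hmax⟩) hg).trans hw

theorem traceAB_eq_zero_of_mem_H_domain {w : (ℝ → ℂ) × (ℝ → ℂ)} {g : S.L2}
    (hg : S.Represents w g) (hmem : g ∈ (S.H A B).domain) : traceAB S.a S.b A B w = 0 := by
  obtain ⟨⟨g', hker, rfl⟩, -⟩ := hmem
  exact (S.traceAB_congr A B hg (S.represents_repr g')).trans hker

theorem H_apply_ae_eq {w : (ℝ → ℂ) × (ℝ → ℂ)} (g : (S.H A B).domain) (hg : S.Represents w g) :
    S.H A B g =ᵐ[S.μ] S.tau w := by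
  have h1 : S.H A B g = S.Hmax ⟨g, g.2.2⟩ := LinearPMap.domRestrict_apply rfl
  rw [h1]
  exact (S.represents_repr ⟨g, g.2.2⟩).memLp.coeFn_toLp.trans
    ((S.represents_repr ⟨g, g.2.2⟩).tau_ae_eq S hg)

/-- Only g has to satisfy the boundary condition; f ranges over the maximal domain, which is what
allows Poisson solutions to be inserted for it. -/
theorem inner_H_sub_H_inner (hAB : IsBoundaryPair A B) {v w : (ℝ → ℂ) × (ℝ → ℂ)} {f h : S.L2}
    (hf : S.Represents v f) (hh : h =ᵐ[S.μ] S.tau v) (g : (S.H A B).domain)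
    (hg : S.Represents w g) :
    ⟪f, S.H A B g⟫_ℂ - ⟪h, g⟫_ℂ =
      ⟪traceAB S.a S.b A B v, tracePerp S.a S.b A B w⟫_ℂ := by
  rw [S.inner_sub_inner_eq_traces hf hg hh (S.H_apply_ae_eq g hg)]
  exact hAB.boundary_form (S.traceAB_eq_zero_of_mem_H_domain hg g.2)

theorem H_symmetric (hAB : IsBoundaryPair A B) (f g : (S.H A B).domain) :
    ⟪S.H A B f, (g : S.L2)⟫_ℂ = ⟪(f : S.L2), S.H A B g⟫_ℂ := by
  obtain ⟨v, hv⟩ := f.2.2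
  obtain ⟨w, hw⟩ := g.2.2
  have := S.inner_H_sub_H_inner hAB hv (S.H_apply_ae_eq f hv) g hw
  rw [S.traceAB_eq_zero_of_mem_H_domain hv f.2, inner_zero_left, sub_eq_zero] at this
  exact this.symm

/-! ### Solvability of the boundary value problem from injectivity of H - z -/

variable {z : ℂ}

/-- Such a solution lies in the kernel of H - z, so its L² class vanishes; uniqueness of absolutely
continuous representatives turns this into pointwise vanishing. -/
theorem eqOn_zero_of_traceAB_eq_zero
    (hinj : ∀ g : (S.H A B).domain, S.H A B g = z • (g : S.L2) → (g : S.L2) = 0)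
    {w : (ℝ → ℂ) × (ℝ → ℂ)} (hw : w ∈ S.solutions z) (ht : traceAB S.a S.b A B w = 0) :
    EqOn w.1 0 (Icc S.a S.b) ∧ EqOn w.2 0 (Icc S.a S.b) := by
  have hr := Represents.of_mem_solutions S hw
  set g : S.L2 := (S.memLp_of_ac hw.1.1).toLp w.1
  have hg0 : g = 0 := hinj ⟨g, S.mem_H_domain_of_represents hr ht⟩
    (Lp.ext ((S.H_apply_ae_eq _ hr).trans (hr.tau_ae_eq_smul S hw).symm))
  rw [hg0] at hr
  have h0 : S.Represents 0 0 :=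
    ⟨S.acPairs.zero_mem, Lp.coeFn_zero ℂ 2 S.μ, MemLp.zero.ae_eq
      (Filter.Eventually.of_forall fun x => by simp [tau])⟩
  exact hr.eqOn S h0

/-- The trace restricted to combinations of two fundamental solutions is an injective endomorphism
of ℂ², hence surjective. -/
theorem exists_isBVPSolution
    (hinj : ∀ g : (S.H A B).domain, S.H A B g = z • (g : S.L2) → (g : S.L2) = 0)
    (c : EuclideanSpace ℂ (Fin 2)) : ∃ w, S.IsBVPSolution A B z c w := by
  have hfund : ∀ α β : ℂ, ∃ w ∈ S.solutions z, w.1 S.a = α ∧ w.2 S.a = β := by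
    intro α β
    obtain ⟨w, g, hg, ha, hb, ht⟩ := S.exists_represents_inhomogeneous z 0 α β
    rw [add_zero] at ht
    exact ⟨w, ⟨hg.mem, ht.trans ((Lp.coeFn_smul z g).trans (hg.ae_eq.const_smul z))⟩, ha, hb⟩
  obtain ⟨w₁, hw₁, ha₁, hb₁⟩ := hfund 1 0
  obtain ⟨w₂, hw₂, ha₂, hb₂⟩ := hfund 0 1
  have hmem : ∀ d, linearComb w₁ w₂ d ∈ S.solutions z := fun d =>
    add_mem ((S.solutions z).smul_mem _ hw₁) ((S.solutions z).smul_mem _ hw₂)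
  have hi : Function.Injective (traceAB S.a S.b A B ∘ₗ linearComb w₁ w₂) := by
    rw [injective_iff_map_eq_zero]
    intro d hd
    -- The initial data (1, 0) and (0, 1) at a make the values there equal to the coefficients of d.
    obtain ⟨e1, e2⟩ := S.eqOn_zero_of_traceAB_eq_zero hinj (hmem d) hd
    have f1 := e1 (left_mem_Icc.2 S.a_lt_b.le)
    have f2 := e2 (left_mem_Icc.2 S.a_lt_b.le)
    simp only [linearComb_apply, Prod.fst_add, Prod.snd_add, Prod.smul_fst, Prod.smul_snd,
      Pi.add_apply, Pi.smul_apply, ha₁, ha₂, hb₁, hb₂, smul_eq_mul, mul_one, mul_zero, add_zero,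
      zero_add, Pi.zero_apply] at f1 f2
    ext i
    fin_cases i
    · exact f1
    · exact f2
  obtain ⟨d, hd⟩ := LinearMap.injective_iff_surjective.1 hi c
  exact ⟨_, S.isBVPSolution_iff.2 ⟨hmem d, hd⟩⟩

theorem bvpWellPosed_of_injective
    (hinj : ∀ g : (S.H A B).domain, S.H A B g = z • (g : S.L2) → (g : S.L2) = 0) :
    S.BVPWellPosed A B z := by
  intro c
  obtain ⟨w, hw⟩ := S.exists_isBVPSolution hinj c
  refine ⟨w, hw, fun w' hw' => ?_⟩
  rw [isBVPSolution_iff] at hw hw'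
  obtain ⟨e1, e2⟩ := S.eqOn_zero_of_traceAB_eq_zero hinj (sub_mem hw'.1 hw.1)
    (by rw [map_sub, hw'.2, hw.2, sub_self])
  exact ⟨fun x hx => sub_eq_zero.1 (e1 hx), fun x hx => sub_eq_zero.1 (e2 hx)⟩

/-- Any solution of the inhomogeneous equation is corrected by the homogeneous solution with the
same trace. Assuming injectivity alone is what makes the argument usable at z̄, before z̄ is known
to lie in the resolvent set. -/
theorem H_sub_smul_surjective
    (hinj : ∀ g : (S.H A B).domain, S.H A B g = z • (g : S.L2) → (g : S.L2) = 0) (f : S.L2) :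
    ∃ g : (S.H A B).domain, S.H A B g - z • (g : S.L2) = f := by
  obtain ⟨w₀, g₀, hg₀, -, -, ht₀⟩ := S.exists_represents_inhomogeneous z f 0 0
  obtain ⟨w₁, hw₁⟩ := S.exists_isBVPSolution hinj (traceAB S.a S.b A B w₀)
  obtain ⟨hs₁, htr₁⟩ := S.isBVPSolution_iff.1 hw₁
  have hr₁ := (Represents.of_mem_solutions S hs₁)
  have hs := (S.solutions z).smul_mem (-1) hs₁
  have hr := hr₁.smul S (-1)
  set g₁ : S.L2 := (-1 : ℂ) • (S.memLp_of_ac hs₁.1.1).toLp w₁.1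
  have hsum := hg₀.add S hr
  refine ⟨⟨g₀ + g₁, S.mem_H_domain_of_represents hsum (by rw [map_add, map_smul, htr₁]; simp)⟩, ?_⟩
  rw [sub_eq_iff_eq_add]
  refine Lp.ext ((S.H_apply_ae_eq _ hsum).trans ((S.tau_add hg₀.mem hr.mem).trans
    ((ht₀.add (hr.tau_ae_eq_smul S hs).symm).trans ((Lp.coeFn_add _ _).symm.trans ?_))))
  have e : z • g₀ + f + z • g₁ = f + z • (g₀ + g₁) := by
    rw [smul_add]
    abel
  exact Filter.EventuallyEq.of_eq (congrArg (fun h : S.L2 => (h : ℝ → ℂ)) e)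

/-- The resolvent set of `H_{A,B}` is symmetric with respect to the real axis, and
`(H_{A,B} - z̄)⁻¹` is the adjoint of `(H_{A,B} - z)⁻¹`. -/
theorem isResolventAt_adjoint (hAB : IsBoundaryPair A B) {R : S.L2 →L[ℂ] S.L2}
    (hR : IsResolventAt (S.H A B) z R) :
    IsResolventAt (S.H A B) (conj z) (ContinuousLinearMap.adjoint R) := by
  have hsymm : ∀ (g : (S.H A B).domain) (f : S.L2),
      ⟪S.H A B g - conj z • (g : S.L2), R f⟫_ℂ = ⟪(g : S.L2), f⟫_ℂ := by
    intro g f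
    conv_rhs => rw [← hR.right_inv f]
    rw [inner_sub_left, inner_sub_right, inner_smul_left, inner_smul_right, Complex.conj_conj,
      ← S.H_symmetric hAB]
  have hadj : ∀ g : (S.H A B).domain,
      ContinuousLinearMap.adjoint R (S.H A B g - conj z • (g : S.L2)) = g := by
    intro g
    refine ext_inner_right ℂ fun f => ?_
    rw [ContinuousLinearMap.adjoint_inner_left, hsymm]
  have hinj : ∀ g : (S.H A B).domain, S.H A B g = conj z • (g : S.L2) → (g : S.L2) = 0 := by
    intro g hg
    rw [← hadj g, hg, sub_self, map_zero]
  -- The left inverse gives injectivity at z̄; surjectivity then puts the range of the adjoint in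
  -- the domain and upgrades it to a two-sided inverse.
  have hsurj := S.H_sub_smul_surjective hinj
  have hmem : ∀ f, ContinuousLinearMap.adjoint R f ∈ (S.H A B).domain := by
    intro f
    obtain ⟨g, rfl⟩ := hsurj f
    rw [hadj]
    exact g.2
  refine ⟨hmem, fun f => ?_, hadj⟩
  obtain ⟨g, hg⟩ := hsurj f
  have e : (⟨ContinuousLinearMap.adjoint R f, hmem f⟩ : (S.H A B).domain) = g :=
    Subtype.ext ((congrArg _ hg.symm).trans (hadj g))
  have e' : ContinuousLinearMap.adjoint R f = g := congrArg Subtype.val e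
  rw [e, e', hg]

/-- The chosen solution is determined only on [a, b], but the trace sees only the endpoints. -/
theorem Λ_eq_of_isBVPSolution (hwp : S.BVPWellPosed A B z) {c : EuclideanSpace ℂ (Fin 2)}
    {w : (ℝ → ℂ) × (ℝ → ℂ)} (hw : S.IsBVPSolution A B z c w) (A' B' : Matrix (Fin 2) (Fin 2) ℂ) :
    S.Λ A B A' B' z c = traceAB S.a S.b A' B' w := by
  have hex : ∃ w, S.IsBVPSolution A B z c w := ⟨w, hw⟩
  rw [Λ, dif_pos hex]
  obtain ⟨w₀, -, huniq⟩ := hwp c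
  obtain ⟨e1, e2⟩ := huniq w hw
  obtain ⟨e1', e2'⟩ := huniq _ (Classical.choose_spec hex)
  have ha : S.a ∈ Icc S.a S.b := left_mem_Icc.2 S.a_lt_b.le
  have hb : S.b ∈ Icc S.a S.b := right_mem_Icc.2 S.a_lt_b.le
  simp [traceAB, evalPair, e1 ha, e1 hb, e2 ha, e2 hb, e1' ha, e1' hb, e2' ha, e2' hb]

/-- The Poisson operator `c ↦ u_{A,B}(z, · ; c)` as a map `ℂ² → L²((a, b); r dx)`. -/
theorem exists_poisson_operator (hwp : S.BVPWellPosed A B z) :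
    ∃ T : EuclideanSpace ℂ (Fin 2) →L[ℂ] S.L2, ∀ c, ∃ w, S.IsBVPSolution A B z c w ∧
      S.Represents w (T c) := by
  obtain ⟨w₁, hw₁, -⟩ := hwp !₂[1, 0]
  obtain ⟨w₂, hw₂, -⟩ := hwp !₂[0, 1]
  rw [isBVPSolution_iff] at hw₁ hw₂
  have hr₁ := Represents.of_mem_solutions S hw₁.1
  have hr₂ := Represents.of_mem_solutions S hw₂.1
  refine ⟨LinearMap.toContinuousLinearMap (linearComb _ _), fun c => ⟨linearComb w₁ w₂ c, ?_,
    (hr₁.smul S (c 0)).add S (hr₂.smul S (c 1))⟩⟩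
  refine S.isBVPSolution_iff.2 ⟨add_mem ((S.solutions z).smul_mem _ hw₁.1)
    ((S.solutions z).smul_mem _ hw₂.1), ?_⟩
  rw [linearComb_apply, map_add, map_smul, map_smul, hw₁.2, hw₂.2]
  ext i
  fin_cases i <;> simp

end Coeff

end SturmLiouville

end

/-! ### The resolvent formulas for the boundary data map -/

theorem theoremt4 (S : SturmLiouville.Coeff) (A B A' B' : Matrix (Fin 2) (Fin 2) ℂ)
    (hAB : SturmLiouville.IsBoundaryPair A B) (hAB' : SturmLiouville.IsBoundaryPair A' B')
    (z : ℂ) (hz : z ∈ SturmLiouville.resolventSet (S.H A B)) :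
    -- the boundary value problem that defines the boundary data map is uniquely solvable
    S.BVPWellPosed A B z ∧
    ∃ hz' : conj z ∈ SturmLiouville.resolventSet (S.H A B),
    -- `G = γ_{A',B'} (H_{A,B} - z̄)⁻¹` and `G' = γ⊥_{A,B} (H_{A,B} - z̄)⁻¹` are bounded
    ∃ G G' : S.L2 →L[ℂ] EuclideanSpace ℂ (Fin 2),
      (∀ f : S.L2, G f = S.γ A' B' (S.resolventMax A B hz' f)) ∧
      (∀ f : S.L2, G' f = S.γPerp A B (S.resolventMax A B hz' f)) ∧
      (∀ c : EuclideanSpace ℂ (Fin 2), ∃ h : ContinuousLinearMap.adjoint G c ∈ S.maxDomain,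
        S.Λ A B A' B' z (Matrix.toEuclideanLin (SturmLiouville.matS A' B' A B)ᴴ c) =
          S.γ A' B' ⟨ContinuousLinearMap.adjoint G c, h⟩) ∧
      (∀ c : EuclideanSpace ℂ (Fin 2), ∃ h : ContinuousLinearMap.adjoint G' c ∈ S.maxDomain,
        S.Λ A B A' B' z c = S.γ A' B' ⟨ContinuousLinearMap.adjoint G' c, h⟩) := by
  have hinj : ∀ g : (S.H A B).domain, S.H A B g = z • (g : S.L2) → (g : S.L2) = 0 := by
    intro g hg
    rw [← (SturmLiouville.isResolventAt_resolvent _ hz).left_inv g, hg, sub_self, map_zero]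
  have hwp := S.bvpWellPosed_of_injective hinj
  have hz' : conj z ∈ SturmLiouville.resolventSet (S.H A B) :=
    ⟨_, S.isResolventAt_adjoint hAB (SturmLiouville.isResolventAt_resolvent _ hz)⟩
  obtain ⟨T, hT⟩ := S.exists_poisson_operator hwp
  have hR := SturmLiouville.isResolventAt_resolvent _ hz'
  -- T* = γ⊥(H - z̄)⁻¹: test against d and apply Green's formula to Td and (H - z̄)⁻¹f. The inner
  -- product is conjugate-linear in its first slot, so the eigenvalue z of Td matches the spectral
  -- parameter z̄.
  have hperp : ∀ f, ContinuousLinearMap.adjoint T f =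
      S.γPerp A B (S.resolventMax A B hz' f) := by
    intro f
    refine ext_inner_left ℂ fun d => ?_
    obtain ⟨w, hw, hr⟩ := hT d
    obtain ⟨hs, htr⟩ := S.isBVPSolution_iff.1 hw
    have hgreen := S.inner_H_sub_H_inner hAB hr (hr.tau_ae_eq_smul S hs)
      ⟨_, hR.mem_domain f⟩ (S.represents_repr (S.resolventMax A B hz' f))
    rw [htr, inner_smul_left] at hgreen
    rw [ContinuousLinearMap.adjoint_inner_right]
    conv_lhs => rw [← hR.right_inv f]
    rw [inner_sub_right, inner_smul_right]
    exact hgreen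
  have hΛ : ∀ c (h : T c ∈ S.maxDomain), S.Λ A B A' B' z c = S.γ A' B' ⟨T c, h⟩ := by
    intro c h
    obtain ⟨w, hw, hr⟩ := hT c
    rw [S.Λ_eq_of_isBVPSolution hwp hw]
    exact S.traceAB_congr A' B' hr (S.represents_repr ⟨T c, h⟩)
  have hmax : ∀ c, T c ∈ S.maxDomain := fun c => (hT c).imp fun _ h => h.2
  set L := LinearMap.toContinuousLinearMap
    (Matrix.toEuclideanLin (SturmLiouville.matS A' B' A B)) with hL
  -- (ST*)* = TS*, which brings S* inside the argument of Λ.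
  have hadj : ∀ c, ContinuousLinearMap.adjoint (L ∘L ContinuousLinearMap.adjoint T) c =
      T (Matrix.toEuclideanLin (SturmLiouville.matS A' B' A B)ᴴ c) := by
    intro c
    refine ext_inner_right ℂ fun f => ?_
    rw [ContinuousLinearMap.adjoint_inner_left, ← ContinuousLinearMap.adjoint_inner_right,
      SturmLiouville.toEuclideanLin_conjTranspose_inner]
    rfl
  refine ⟨hwp, hz', L ∘L ContinuousLinearMap.adjoint T, ContinuousLinearMap.adjoint T,
    fun f => ?_, hperp, fun c => ?_, fun c => ?_⟩
  · rw [ContinuousLinearMap.comp_apply, hperp]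
    exact (hAB.traceAB_eq_matS (S.traceAB_eq_zero_of_mem_H_domain
      (S.represents_repr (S.resolventMax A B hz' f)) (hR.mem_domain f)) A' B').symm
  · simp only [hadj]
    exact ⟨hmax _, hΛ _ _⟩
  · simp only [ContinuousLinearMap.adjoint_adjoint]
    exact ⟨hmax _, hΛ _ _⟩
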